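/- Let $K$ be a field of characteristic zero, let $n,d\ge 1$ be integers, and let $S=K[X_1,\dots,X_n]$ with its standard grading and irrelevant ideal $S_+=(X_1,\dots,X_n)$. Put $\mathbb N^n_d=\{a\in\mathbb N^n : a_1+\dots+a_n=d\}$ and write $X^a=X_1^{a_1}\cdots X_n^{a_n}$. For $a,b\in\mathbb N^n_d$ write $a\ge_{\mathrm{Bor}} b$ if $a-b=\sum_{j=1}^{n-1}\alpha_j(e_j-e_{j+1})$ for some $\alpha_1,\dots,\alpha_{n-1}\in\mathbb N$, where $e_1,\dots,e_n$ are the standard vectors. A subset $B\subset\mathbb N^n_d$ is a Borel set if $a\in B$, $b\in\mathbb N^n_d$ and $b\ge_{\mathrm{Bor}}a$ imply $b\in B$. A binomial system (of degree $d$ in $n$ indeterminates) is a triple $(A,C,\rho)$ with $A,C\subset\mathbb N^n_d$ and $\rho\in\mathbb Z^n$ such that (i) $C+\rho\subset\mathbb N^n_d$; (ii) $A\cap C=A\cap(C+\rho)=C\cap(C+\rho)=\emptyset$; (iii) $A\cup C$ and $A\cup(C+\rho)$ are Borel sets. Its ideal is $$F(A,C,\rho)=\bigl(\{X^a : a\in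 A\}\cup\{X^c-X^{c+\rho} : c\in C\}\bigr)\subset S.$$ The saturation of an ideal $\mathfrak a\subset S$ is $\mathfrak a^{\mathrm{sat}}=\bigcup_{k\ge 0}(\mathfrak a: S_+^k)$. A finitely generated graded $S$-module $M\neq 0$ is Cohen–Macaulay if $\operatorname{depth}M=\dim M$, where $\operatorname{depth}M$ is the maximal length of an $M$-regular sequence of elements of $S_+$ and $\dim M$ is the Krull dimension of $M$. A homogeneous ideal $\mathfrak a\subset S$ is sequentially Cohen–Macaulay if there is a finite chain $\mathfrak a=\mathfrak a_0\subsetneq\mathfrak a_1\subsetneq\dots\subsetneq\mathfrak a_r=S$ ($r\ge 0$) of homogeneous ideals such that $\mathfrak a_i/\mathfrak a_{i-1}$ is Cohen–Macaulay for $1\le i\le r$ and $\dim(\mathfrak a_i/\mathfrak a_{i-1})<\dim(\mathfrak a_{i+1}/\mathfrak a_i)$ for $1\le i<r$. **Proposition.** For every binomial system $(A,C,\rho)$, the ideals $F(A,C,\rho)$ and $F(A,C,\rho)^{\mathrm{sat}}$ are (homogeneous and) sequentially Cohen–Macaulay. -/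

import Mathlib

namespace BinomialSystem

open MvPolynomial

/-! ### Cohen-Macaulay graded modules -/

/-- The grade of the ideal `I` on the module `M`: the supremum of the lengths of the
`M`-regular sequences consisting of elements of `I`. -/
noncomputable def grade {R : Type*} [CommRing R] (I : Ideal R)
    (M : Type*) [AddCommGroup M] [Module R M] : ℕ∞ :=
  ⨆ (rs : List R) (_ : (∀ r ∈ rs, r ∈ I) ∧ RingTheory.Sequence.IsRegular M rs),
    (rs.length : ℕ∞)

/-- The irrelevant ideal `S₊` of the standard graded polynomial ring `S = K[X₁, …, Xₙ]`,
i.e. the ideal generated by the indeterminates. -/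
noncomputable def irrelevant (n : ℕ) (K : Type*) [Field K] : Ideal (MvPolynomial (Fin n) K) :=
  Ideal.span (Set.range X)

/-- The depth of a (finitely generated graded) `S`-module: the grade of `S₊` on it. -/
noncomputable def depth (n : ℕ) (K : Type*) [Field K]
    (M : Type*) [AddCommGroup M] [Module (MvPolynomial (Fin n) K) M] : ℕ∞ :=
  grade (irrelevant n K) M

/-- A finitely generated graded `S`-module `M ≠ 0` is Cohen-Macaulay if its depth equals its
Krull dimension (the zero module has dimension `⊥`). -/
def IsCohenMacaulay (n : ℕ) (K : Type*) [Field K]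
    (M : Type*) [AddCommGroup M] [Module (MvPolynomial (Fin n) K) M] : Prop :=
  ((depth n K M : ℕ∞) : WithBot ℕ∞) = Module.supportDim (MvPolynomial (Fin n) K) M

/-- For ideals `I ⊆ J` of a ring `R`, the `R`-module `J / I`. -/
abbrev IdealQuot {R : Type*} [CommRing R] (J I : Ideal R) : Type _ :=
  ↥J ⧸ Submodule.submoduleOf I J

/-- The ideal is homogeneous for the standard grading of `S`. -/
def IsHomogeneousIdeal {n : ℕ} {K : Type*} [Field K] (I : Ideal (MvPolynomial (Fin n) K)) :
    Prop :=
  letI : GradedAlgebra (homogeneousSubmodule (Fin n) K) := MvPolynomial.gradedAlgebra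
  I.IsHomogeneous (homogeneousSubmodule (Fin n) K)

/-- A homogeneous ideal `I` of `S` is sequentially Cohen-Macaulay if there is a finite chain
`I = a 0 ⊊ a 1 ⊊ … ⊊ a r = S` of homogeneous ideals whose successive quotients are
Cohen-Macaulay of strictly increasing dimension. -/
def IsSequentiallyCM {n : ℕ} {K : Type*} [Field K] (I : Ideal (MvPolynomial (Fin n) K)) :
    Prop :=
  ∃ (r : ℕ) (a : ℕ → Ideal (MvPolynomial (Fin n) K)),
    a 0 = I ∧ a r = ⊤ ∧
    (∀ i ≤ r, IsHomogeneousIdeal (a i)) ∧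
    (∀ i < r, a i < a (i + 1)) ∧
    (∀ i < r, IsCohenMacaulay n K (IdealQuot (a (i + 1)) (a i))) ∧
    (∀ i, i + 1 < r →
      Module.supportDim (MvPolynomial (Fin n) K) (IdealQuot (a (i + 1)) (a i)) <
        Module.supportDim (MvPolynomial (Fin n) K) (IdealQuot (a (i + 2)) (a (i + 1))))

/-- The saturation `(I : S₊^∞) = ⋃ₖ (I : S₊^k)`. The union is increasing, so it is the supremum
of the ideals `(I : S₊^k)`. -/
noncomputable def saturation {n : ℕ} {K : Type*} [Field K]
    (I : Ideal (MvPolynomial (Fin n) K)) : Ideal (MvPolynomial (Fin n) K) :=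
  ⨆ k : ℕ, Submodule.colon I ((irrelevant n K ^ k : Ideal (MvPolynomial (Fin n) K)) :
    Set (MvPolynomial (Fin n) K))

/-! ### Borel sets and binomial systems -/

/-- The set of exponents `a ∈ ℕⁿ` with `a₁ + … + aₙ = d`. -/
def exponents (n d : ℕ) : Set (Fin n →₀ ℕ) := {a | ∑ i, a i = d}

/-- The Borel order `a ≥ b`: the difference `a - b` is a combination of the vectors
`e_j - e_{j+1}`, `1 ≤ j < n`, with coefficients in `ℕ`. -/
def BorelGE {n : ℕ} (a b : Fin n →₀ ℕ) : Prop :=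
  ∃ α : Fin (n - 1) → ℕ,
    (fun i => (a i : ℤ) - (b i : ℤ)) =
      ∑ j : Fin (n - 1), (α j : ℤ) •
        ((Pi.single ⟨j, by omega⟩ 1 : Fin n → ℤ) - Pi.single ⟨j + 1, by omega⟩ 1)

/-- A Borel set in degree `d`: a subset of `ℕⁿ_d` closed upwards for the Borel order. -/
def IsBorelSet {n : ℕ} (d : ℕ) (B : Set (Fin n →₀ ℕ)) : Prop :=
  B ⊆ exponents n d ∧
    ∀ a ∈ exponents n d, ∀ b ∈ exponents n d, a ∈ B → BorelGE b a → b ∈ B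

/-- `b = c + ρ` for `b, c ∈ ℕⁿ` and `ρ ∈ ℤⁿ`. -/
def IsTranslate {n : ℕ} (ρ : Fin n → ℤ) (c b : Fin n →₀ ℕ) : Prop :=
  ∀ i, (b i : ℤ) = (c i : ℤ) + ρ i

/-- The set of the vectors `c + ρ`, `c ∈ C`, that lie in `ℕⁿ`; this is `C + ρ`
if `C + ρ ⊆ ℕⁿ`. -/
def shiftSet {n : ℕ} (C : Set (Fin n →₀ ℕ)) (ρ : Fin n → ℤ) : Set (Fin n →₀ ℕ) :=
  {b | ∃ c ∈ C, IsTranslate ρ c b}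

/-- `(A, C, ρ)` is a binomial system of degree `d` in `n` indeterminates. -/
structure IsBinomialSystem (n d : ℕ) (A C : Set (Fin n →₀ ℕ)) (ρ : Fin n → ℤ) : Prop where
  A_subset : A ⊆ exponents n d
  C_subset : C ⊆ exponents n d
  shift_subset : ∀ c ∈ C, ∃ b ∈ exponents n d, IsTranslate ρ c b
  A_inter_C : A ∩ C = ∅
  A_inter_shift : A ∩ shiftSet C ρ = ∅
  C_inter_shift : C ∩ shiftSet C ρ = ∅
  borel_left : IsBorelSet d (A ∪ C)
  borel_right : IsBorelSet d (A ∪ shiftSet C ρ)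

/-- The set of monomials `X^A`. -/
noncomputable def monomials {n : ℕ} (K : Type*) [Field K] (A : Set (Fin n →₀ ℕ)) :
    Set (MvPolynomial (Fin n) K) :=
  {f | ∃ a ∈ A, f = monomial a 1}

/-- The set of binomials `X^c - X^(c+ρ)`, `c ∈ C`. -/
noncomputable def binomials {n : ℕ} (K : Type*) [Field K] (C : Set (Fin n →₀ ℕ))
    (ρ : Fin n → ℤ) : Set (MvPolynomial (Fin n) K) :=
  {f | ∃ c ∈ C, ∃ b, IsTranslate ρ c b ∧ f = monomial c 1 - monomial b 1}

/-- The ideal `F(A, C, ρ)` generated by `X^A` and the binomials `X^c - X^(c+ρ)`, `c ∈ C`. -/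
noncomputable def F {n : ℕ} (K : Type*) [Field K] (A C : Set (Fin n →₀ ℕ)) (ρ : Fin n → ℤ) :
    Ideal (MvPolynomial (Fin n) K) :=
  Ideal.span (monomials K A ∪ binomials K C ρ)

end BinomialSystem

/-! Number the variables X_0, …, X_{n-1}, and let `tailSat m I` be the saturation of I by
X_m⋯X_{n-1}. If C is nonempty, let L be the last index with ρ_L ≠ 0. As (A, C, ρ) and (A, C+ρ, -ρ)
have the same ideal (`F_neg`), one may assume ρ_L > 0. With B = A ∪ C ∪ (C+ρ), the chain is, up to
repetitions, `tailSat m F` for m = n, …, L, then `tailSat m (X^B)` for m = L-1, …, 0, then S. If C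
is empty, F = (X^A) and only monomial ideals occur.

Consider the quotient whose smaller ideal has index m. Each of its elements is killed by a power of
every X_j with j < m; X_m is a nonzerodivisor on it, because the smaller ideal is saturated; and for
j > m both ideals are extended from polynomials without X_j, as ρ_j = 0. So X_m, …, X_{n-1} is a
regular sequence and the dimension is n - m (`isCohenMacaulay_idealQuot`).

The nilpotency comes from the Borel property. For a Borel monomial ideal, the letters of a tail
monomial may be replaced by earlier ones (`X_pow_mul_mem_of_tail_mul_mem`). For F, elements of (X^B)
can be moved modulo F into (X^{A ∪ (C+ρ)}), which meets F only in (X^A)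
(`mem_span_monomials_of_mem_F`; this needs ρ_L > 0, through `translate_mem_multiples`). The monomial
case for A then finishes (`X_pow_mul_mem_F`). Where the chain passes from F to (X^B), powers of X_j
with j < L carry (X^{A ∪ (C+ρ)}) into (X^A) (`X_pow_mul_mem_F_of_lt`). Finally F^sat is `tailSat (n
- 1) F`, a member of the same chain. -/

namespace BinomialSystem

open MvPolynomial RingTheory.Sequence

/-! ### Regular sequences and dimension -/

section Regular

variable {R : Type*} [CommRing R]

/-- A nonzerodivisor on M avoids the minimal primes of the support, so dividing by it lowers the
dimension by at least one. -/
theorem length_le_supportDim_of_isRegular (rs : List R) :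
    ∀ (M : Type*) [AddCommGroup M] [Module R M] [Module.Finite R M],
      IsRegular M rs → ((rs.length : ℕ∞) : WithBot ℕ∞) ≤ Module.supportDim R M := by
  induction rs with
  | nil =>
    intro M _ _ _ h
    have : Nontrivial M := h.nontrivial
    have hne := Module.supportDim_ne_bot_of_nontrivial R M
    obtain ⟨e, he⟩ := WithBot.ne_bot_iff_exists.mp hne
    rw [← he]
    exact WithBot.coe_le_coe.mpr (by simp)
  | cons r rs ih =>
    intro M _ _ _ h
    rw [isRegular_cons_iff] at h
    have h1 := ih _ h.2
    have h2 := Module.supportDim_quotSMulTop_succ_le_of_notMem_minimalPrimes (M := M) (x := r)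
      (fun _ ↦ h.1.notMem_of_mem_minimalPrimes)
    refine le_trans ?_ h2
    rw [List.length_cons, Nat.cast_add, Nat.cast_one, WithBot.coe_add]
    exact add_le_add_left h1 _

end Regular

theorem mk_mem_smul_top_iff {R : Type*} [CommRing R] {I J : Ideal R} (hIJ : I ≤ J) (𝔞 : Ideal R)
    (f : J) :
    (Submodule.Quotient.mk f : IdealQuot J I) ∈ (𝔞 • ⊤ : Submodule R (IdealQuot J I)) ↔
      (f : R) ∈ I ⊔ 𝔞 * J := by
  have h1 : (𝔞 • ⊤ : Submodule R (IdealQuot J I)) =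
      Submodule.map (Submodule.mkQ (Submodule.submoduleOf I J)) (𝔞 • ⊤) := by
    rw [Submodule.map_smul'', Submodule.map_top, Submodule.range_mkQ]
  have h2 : (Submodule.Quotient.mk f : IdealQuot J I) ∈ (𝔞 • ⊤ : Submodule R (IdealQuot J I)) ↔
      f ∈ Submodule.submoduleOf I J ⊔ (𝔞 • ⊤ : Submodule R J) := by
    rw [h1, ← Submodule.comap_map_mkQ]
    rfl
  have h3 : Submodule.map (Submodule.subtype J)
      (Submodule.submoduleOf I J ⊔ (𝔞 • ⊤ : Submodule R J)) = I ⊔ 𝔞 * J := by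
    rw [Submodule.map_sup, Submodule.map_smul'', Submodule.map_top, Submodule.range_subtype,
      Submodule.submoduleOf, Submodule.map_comap_subtype, inf_eq_right.mpr hIJ]
    rfl
  rw [h2, ← h3]
  constructor
  · exact fun h ↦ ⟨f, h, rfl⟩
  · rintro ⟨g, hg, hgf⟩
    rwa [← Subtype.ext hgf]

/-! ### Coefficients in one variable and weighted gradings -/

section Poly

variable {n : ℕ} {K : Type*} [Field K]

/-- The `K`-linear endomorphism with prescribed values on the monomials. -/
noncomputable def monomialMap (g : (Fin n →₀ ℕ) → MvPolynomial (Fin n) K) :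
    MvPolynomial (Fin n) K →ₗ[K] MvPolynomial (Fin n) K :=
  (basisMonomials (Fin n) K).constr K g

@[simp] theorem monomialMap_monomial (g : (Fin n →₀ ℕ) → MvPolynomial (Fin n) K)
    (s : Fin n →₀ ℕ) : monomialMap g (monomial s 1) = g s := by
  simpa [monomialMap] using (basisMonomials (Fin n) K).constr_basis K g s

theorem linearMap_ext_monomial {N : Type*} [AddCommMonoid N] [Module K N]
    {f g : MvPolynomial (Fin n) K →ₗ[K] N} (h : ∀ s, f (monomial s 1) = g (monomial s 1)) :
    f = g :=
  (basisMonomials (Fin n) K).ext (by simpa using h)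

/-- The coefficient of `X_j ^ k` of a polynomial, considered as a polynomial in `X_j`. -/
noncomputable def coeffVar (j : Fin n) (k : ℕ) :
    MvPolynomial (Fin n) K →ₗ[K] MvPolynomial (Fin n) K :=
  monomialMap fun s ↦ if s j = k then monomial (s.erase j) 1 else 0

theorem weightedHomogeneousComponent_monomial_one (w : Fin n → ℕ) (k : ℕ) (s : Fin n →₀ ℕ) :
    weightedHomogeneousComponent w k (monomial s (1 : K)) =
      if Finsupp.weight w s = k then monomial s 1 else 0 := by
  classical
  ext t
  rw [coeff_weightedHomogeneousComponent, coeff_monomial]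
  by_cases hst : s = t
  · subst hst
    split_ifs <;> simp_all
  · split_ifs <;> simp_all [coeff_monomial]

theorem weight_single_one (j : Fin n) (s : Fin n →₀ ℕ) :
    Finsupp.weight (Pi.single j 1 : Fin n → ℕ) s = s j := by
  simp [Finsupp.weight_apply, Finsupp.sum_fintype, Pi.single_apply]

theorem X_pow_mul_coeffVar (j : Fin n) (k : ℕ) (f : MvPolynomial (Fin n) K) :
    X j ^ k * coeffVar j k f = weightedHomogeneousComponent (Pi.single j 1 : Fin n → ℕ) k f := by
  refine LinearMap.congr_fun (f := LinearMap.mulLeft K (X j ^ k) ∘ₗ coeffVar j k)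
    (linearMap_ext_monomial fun s ↦ ?_) f
  rw [weightedHomogeneousComponent_monomial_one, weight_single_one]
  simp only [LinearMap.comp_apply, LinearMap.mulLeft_apply, coeffVar, monomialMap_monomial]
  split_ifs with h
  · rw [X_pow_eq_monomial, monomial_mul, one_mul, ← h, Finsupp.single_add_erase]
  · simp

theorem coeffVar_X_mul_of_ne {i j : Fin n} (hij : i ≠ j) (k : ℕ) (f : MvPolynomial (Fin n) K) :
    coeffVar j k (X i * f) = X i * coeffVar j k f := by
  refine LinearMap.congr_fun (f := coeffVar j k ∘ₗ LinearMap.mulLeft K (X i))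
    (g := LinearMap.mulLeft K (X i) ∘ₗ coeffVar j k) (linearMap_ext_monomial fun s ↦ ?_) f
  simp only [LinearMap.comp_apply, LinearMap.mulLeft_apply, X, monomial_mul, one_mul, coeffVar,
    monomialMap_monomial, Finsupp.add_apply, Finsupp.single_eq_of_ne' hij, zero_add]
  split_ifs with h
  · rw [monomial_mul, one_mul, Finsupp.erase_add, Finsupp.erase_single_ne hij.symm]
  · simp

theorem coeffVar_succ_X_mul (j : Fin n) (k : ℕ) (f : MvPolynomial (Fin n) K) :
    coeffVar j (k + 1) (X j * f) = coeffVar j k f := by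
  have h : coeffVar j (k + 1) ∘ₗ LinearMap.mulLeft K (X j) =
      (coeffVar j k : MvPolynomial (Fin n) K →ₗ[K] _) := by
    refine linearMap_ext_monomial fun s ↦ ?_
    simp only [LinearMap.comp_apply, LinearMap.mulLeft_apply, X, monomial_mul, one_mul, coeffVar,
      monomialMap_monomial, Finsupp.add_apply, Finsupp.single_eq_same, Finsupp.erase_add,
      Finsupp.erase_single, zero_add]
    simp [add_comm 1]
  rw [← h]
  rfl

theorem mem_of_weightedHomogeneousComponent_mem {I : Ideal (MvPolynomial (Fin n) K)}
    (w : Fin n → ℕ) {f : MvPolynomial (Fin n) K}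
    (h : ∀ k, weightedHomogeneousComponent w k f ∈ I) : f ∈ I := by
  rw [← sum_weightedHomogeneousComponent w f,
    finsum_eq_sum _ (weightedHomogeneousComponent_finsupp f)]
  exact I.sum_mem fun k _ ↦ h k

/-- The ideal is generated by polynomials in which `X_j` does not occur; equivalently, it contains
the coefficients of its elements considered as polynomials in `X_j`. -/
def IsFreeOf (j : Fin n) (I : Ideal (MvPolynomial (Fin n) K)) : Prop :=
  ∀ f ∈ I, ∀ k, coeffVar j k f ∈ I

theorem IsFreeOf.top (j : Fin n) : IsFreeOf j (⊤ : Ideal (MvPolynomial (Fin n) K)) :=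
  fun _ _ _ ↦ trivial

/-- The coefficients of f in powers of X_j are those of X_j f, shifted by one; f is rebuilt from
them. -/
theorem IsFreeOf.mem_of_X_mul_mem {j : Fin n} {I : Ideal (MvPolynomial (Fin n) K)}
    (hI : IsFreeOf j I) {f : MvPolynomial (Fin n) K} (hf : X j * f ∈ I) : f ∈ I := by
  refine mem_of_weightedHomogeneousComponent_mem (Pi.single j 1) fun k ↦ ?_
  rw [← X_pow_mul_coeffVar, ← coeffVar_succ_X_mul]
  exact I.mul_mem_left _ (hI _ hf _)

theorem IsFreeOf.sup {j : Fin n} {I J : Ideal (MvPolynomial (Fin n) K)}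
    (hI : IsFreeOf j I) (hJ : IsFreeOf j J) : IsFreeOf j (I ⊔ J) := by
  intro f hf k
  obtain ⟨g, hg, h, hh, rfl⟩ := Submodule.mem_sup.mp hf
  rw [map_add]
  exact Submodule.add_mem_sup (hI g hg k) (hJ h hh k)

theorem IsFreeOf.span_X_mul {i j : Fin n} (hij : i ≠ j) {J : Ideal (MvPolynomial (Fin n) K)}
    (hJ : IsFreeOf j J) : IsFreeOf j (Ideal.span {X i} * J) := by
  intro f hf k
  obtain ⟨g, hg, rfl⟩ := Ideal.mem_span_singleton_mul.mp hf
  rw [coeffVar_X_mul_of_ne hij]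
  exact Ideal.mul_mem_mul (Ideal.mem_span_singleton_self _) (hJ g hg k)

theorem IsFreeOf.ofList_mul {j : Fin n} {J : Ideal (MvPolynomial (Fin n) K)} (hJ : IsFreeOf j J)
    (l : List (Fin n)) (hl : ∀ i ∈ l, i ≠ j) :
    IsFreeOf j (Ideal.ofList (l.map (X : Fin n → MvPolynomial (Fin n) K)) * J) := by
  induction l with
  | nil =>
    intro f hf k
    have : f = 0 := by simpa using hf
    simp [this]
  | cons i l ih =>
    rw [List.map_cons, Ideal.ofList_cons, Ideal.sup_mul]
    exact (IsFreeOf.span_X_mul (hl i (by simp)) hJ).sup (ih fun i hi ↦ hl i (by simp [hi]))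

/-- The ideal is homogeneous for the grading with weights `w`. -/
def IsWHomogeneous (w : Fin n → ℕ) (I : Ideal (MvPolynomial (Fin n) K)) : Prop :=
  ∀ f ∈ I, ∀ k, weightedHomogeneousComponent w k f ∈ I

theorem isHomogeneousIdeal_iff {I : Ideal (MvPolynomial (Fin n) K)} :
    IsHomogeneousIdeal I ↔ IsWHomogeneous 1 I := by
  have key (k : ℕ) (f : MvPolynomial (Fin n) K) :
      ((MvPolynomial.gradedAlgebra (R := K) (σ := Fin n)).decompose' f k : MvPolynomial (Fin n) K) =
        weightedHomogeneousComponent 1 k f :=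
    decomposition.decompose'_apply f k
  constructor
  · intro h f hf k
    rw [← key]
    exact h k hf
  · intro h k f hf
    have := h f hf k
    rw [← key] at this
    exact this

theorem isWHomogeneous_span {w : Fin n → ℕ} {s : Set (MvPolynomial (Fin n) K)}
    (hs : ∀ f ∈ s, ∃ k, IsWeightedHomogeneous w f k) : IsWHomogeneous w (Ideal.span s) := by
  let : GradedAlgebra (weightedHomogeneousSubmodule K w) := weightedGradedAlgebra K w
  have h : (Ideal.span s).IsHomogeneous (weightedHomogeneousSubmodule K w) :=
    Ideal.homogeneous_span _ _ fun f hf ↦ hs f hf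
  exact fun f hf k ↦ weightedHomogeneousComponent_mem_of_mem K w h hf k

theorem weightedHomogeneousComponent_monomial_mul (w : Fin n → ℕ) (k : ℕ) (t : Fin n →₀ ℕ)
    (f : MvPolynomial (Fin n) K) :
    weightedHomogeneousComponent w (Finsupp.weight w t + k) (monomial t 1 * f) =
      monomial t 1 * weightedHomogeneousComponent w k f := by
  refine LinearMap.congr_fun
    (f := weightedHomogeneousComponent w (Finsupp.weight w t + k) ∘ₗ
      LinearMap.mulLeft K (monomial t 1))
    (g := LinearMap.mulLeft K (monomial t 1) ∘ₗ weightedHomogeneousComponent w k)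
    (linearMap_ext_monomial fun s ↦ ?_) f
  simp only [LinearMap.comp_apply, LinearMap.mulLeft_apply, monomial_mul, one_mul,
    weightedHomogeneousComponent_monomial_one, map_add, add_right_inj]
  split_ifs <;> simp [monomial_mul]

end Poly

/-! ### Cohen-Macaulay quotients and the assembly of chains -/

section CohenMacaulay

variable {n : ℕ} {K : Type*} [Field K]

theorem weightedHomogeneousComponent_zero_X_mul (j : Fin n) (f : MvPolynomial (Fin n) K) :
    weightedHomogeneousComponent (1 : Fin n → ℕ) 0 (X j * f) = 0 := by
  have h : weightedHomogeneousComponent (1 : Fin n → ℕ) 0 ∘ₗ LinearMap.mulLeft K (X j) = 0 := by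
    refine linearMap_ext_monomial fun s ↦ ?_
    simp only [LinearMap.comp_apply, LinearMap.mulLeft_apply, X, monomial_mul, one_mul,
      weightedHomogeneousComponent_monomial_one]
    simp [Finsupp.weight_single]
  exact LinearMap.congr_fun h f

/-- Graded Nakayama, by induction on the degree: a variable raises degrees by one, so components of
elements of S₊J come from lower components of elements of J. Only I has to be homogeneous. -/
theorem le_of_le_sup_irrelevant_mul {I J : Ideal (MvPolynomial (Fin n) K)}
    (hI : IsWHomogeneous 1 I) (h : J ≤ I ⊔ irrelevant n K * J) :
    J ≤ I := by
  have key (k : ℕ) : ∀ f ∈ J, weightedHomogeneousComponent (1 : Fin n → ℕ) k f ∈ I := by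
    induction k with
    | zero =>
      intro f hf
      obtain ⟨g, hg, p, hp, rfl⟩ := Submodule.mem_sup.mp (h hf)
      rw [map_add]
      refine I.add_mem (hI g hg 0) ?_
      refine Submodule.mul_induction_on hp (fun a ha b hb ↦ ?_) fun x y hx hy ↦ ?_
      · induction ha using Submodule.span_induction generalizing b with
        | mem x hx =>
          obtain ⟨j, rfl⟩ := hx
          rw [weightedHomogeneousComponent_zero_X_mul]
          exact I.zero_mem
        | zero => simp
        | add x y _ _ hx hy => rw [add_mul, map_add]; exact I.add_mem (hx b hb) (hy b hb)
        | smul c x _ hx =>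
          rw [smul_eq_mul, mul_comm c, mul_assoc]
          exact hx _ (J.mul_mem_left _ hb)
      · rw [map_add]; exact I.add_mem hx hy
    | succ k ih =>
      intro f hf
      obtain ⟨g, hg, p, hp, rfl⟩ := Submodule.mem_sup.mp (h hf)
      rw [map_add]
      refine I.add_mem (hI g hg _) ?_
      refine Submodule.mul_induction_on hp (fun a ha b hb ↦ ?_) fun x y hx hy ↦ ?_
      · induction ha using Submodule.span_induction generalizing b with
        | mem x hx =>
          obtain ⟨j, rfl⟩ := hx
          have := weightedHomogeneousComponent_monomial_mul (1 : Fin n → ℕ) k (Finsupp.single j 1) b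
          rw [Finsupp.weight_single, Pi.one_apply, smul_eq_mul, mul_one, add_comm] at this
          rw [X, this]
          exact I.mul_mem_left _ (ih b hb)
        | zero => simp
        | add x y _ _ hx hy => rw [add_mul, map_add]; exact I.add_mem (hx b hb) (hy b hb)
        | smul c x _ hx =>
          rw [smul_eq_mul, mul_comm c, mul_assoc]
          exact hx _ (J.mul_mem_left _ hb)
      · rw [map_add]; exact I.add_mem hx hy
  exact fun f hf ↦ mem_of_weightedHomogeneousComponent_mem 1 fun k ↦ key k f hf

theorem ringKrullDim_quotient_span_X_le (m : ℕ) :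
    ringKrullDim (MvPolynomial (Fin n) K ⧸
      (Ideal.span ((X : Fin n → MvPolynomial (Fin n) K) '' {j | j.val < m}))) ≤ (n - m : ℕ) := by
  set P := Ideal.span ((X : Fin n → MvPolynomial (Fin n) K) '' {j | j.val < m})
  let φ : MvPolynomial (Fin (n - m)) K →+* MvPolynomial (Fin n) K ⧸ P :=
    eval₂Hom ((Ideal.Quotient.mk P).comp C) fun t ↦ Ideal.Quotient.mk P (X ⟨m + t, by omega⟩)
  have hφ : Function.Surjective φ := by
    intro q
    obtain ⟨p, rfl⟩ := Ideal.Quotient.mk_surjective q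
    induction p using MvPolynomial.induction_on with
    | C a => exact ⟨C a, by simp [φ]⟩
    | add p q hp hq =>
      obtain ⟨x, hx⟩ := hp
      obtain ⟨y, hy⟩ := hq
      exact ⟨x + y, by rw [map_add, map_add, hx, hy]⟩
    | mul_X p j hp =>
      obtain ⟨x, hx⟩ := hp
      rcases lt_or_ge j.val m with hj | hj
      · refine ⟨0, ?_⟩
        have : Ideal.Quotient.mk P (X j) = 0 :=
          Ideal.Quotient.eq_zero_iff_mem.mpr (Ideal.subset_span ⟨j, hj, rfl⟩)
        rw [map_zero, map_mul, this, mul_zero]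
      · refine ⟨x * X ⟨j - m, by omega⟩, ?_⟩
        rw [map_mul, map_mul, hx]
        congr 1
        simp only [φ, coe_eval₂Hom, eval₂_X]
        congr 3
        omega
  refine (ringKrullDim_le_of_surjective φ hφ).trans ?_
  rw [MvPolynomial.ringKrullDim_of_isNoetherianRing, ringKrullDim_eq_zero_of_field]
  simp

theorem supportDim_idealQuot_le {I J : Ideal (MvPolynomial (Fin n) K)} (m : ℕ)
    (h : ∀ f ∈ J, ∀ j : Fin n, j.val < m → ∃ N : ℕ, X j ^ N * f ∈ I) :
    Module.supportDim (MvPolynomial (Fin n) K) (IdealQuot J I) ≤ (n - m : ℕ) := by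
  refine le_trans ?_ (ringKrullDim_quotient_span_X_le (K := K) m)
  rw [ringKrullDim_quotient]
  have hsub : Module.support (MvPolynomial (Fin n) K) (IdealQuot J I) ⊆ PrimeSpectrum.zeroLocus
      (Ideal.span ((X : Fin n → MvPolynomial (Fin n) K) '' {j | j.val < m}) : Set _) := by
    intro p hp
    obtain ⟨q, hq⟩ := Module.mem_support_iff_exists_annihilator.mp hp
    obtain ⟨f, rfl⟩ := Submodule.Quotient.mk_surjective _ q
    rw [PrimeSpectrum.mem_zeroLocus, SetLike.coe_subset_coe, Ideal.span_le]
    rintro _ ⟨j, hj, rfl⟩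
    obtain ⟨N, hN⟩ := h f f.2 j hj
    refine p.2.mem_of_pow_mem N (hq ?_)
    rw [Submodule.mem_annihilator_span_singleton, ← Submodule.Quotient.mk_smul,
      Submodule.Quotient.mk_eq_zero]
    exact hN
  exact Order.krullDim_le_of_strictMono (Set.inclusion hsub) fun _ _ h ↦ h

/-- For X_m, saturation of I suffices. A later X_j is tested modulo I + (X_m, …, X_{j-1})J, which is
still free of X_j. Freeness is not asked of X_m itself, because F need not be homogeneous in X_L. -/
theorem isWeaklyRegular_idealQuot {I J : Ideal (MvPolynomial (Fin n) K)} (hIJ : I ≤ J) (m : ℕ)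
    (hsat : ∀ j : Fin n, j.val = m → ∀ f, X j * f ∈ I → f ∈ I)
    (hfree : ∀ j : Fin n, m < j.val → IsFreeOf j I ∧ IsFreeOf j J) :
    IsWeaklyRegular (IdealQuot J I)
      ((List.ofFn fun t : Fin (n - m) ↦ (⟨m + t, by omega⟩ : Fin n)).map
        (X : Fin n → MvPolynomial (Fin n) K)) := by
  refine ⟨fun i hi ↦ ?_⟩
  rw [isSMulRegular_quotient_iff_mem_of_smul_mem]
  intro q hq
  obtain ⟨f, rfl⟩ := Submodule.Quotient.mk_surjective _ q
  rw [← Submodule.Quotient.mk_smul, mk_mem_smul_top_iff hIJ] at hq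
  rw [mk_mem_smul_top_iff hIJ]
  simp only [List.getElem_map, List.getElem_ofFn, ← List.map_take, Submodule.coe_smul,
    smul_eq_mul] at hq ⊢
  rcases Nat.eq_zero_or_pos i with rfl | hpos
  · simp only [List.take_zero, List.map_nil, Ideal.ofList_nil, Submodule.bot_mul,
      sup_bot_eq] at hq ⊢
    exact hsat _ (by simp) _ hq
  · have hj := hfree ⟨m + i, by simp at hi; omega⟩ (by simpa using hpos)
    refine IsFreeOf.mem_of_X_mul_mem (hj.1.sup (hj.2.ofList_mul _ fun k hk ↦ ?_)) hq
    obtain ⟨t, ht, rfl⟩ := List.mem_take_iff_getElem.mp hk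
    simp only [List.getElem_ofFn, ne_eq, Fin.mk.injEq]
    omega

/-- A criterion for a quotient of homogeneous ideals to be Cohen-Macaulay of dimension `n - m`. -/
theorem isCohenMacaulay_idealQuot {I J : Ideal (MvPolynomial (Fin n) K)} (hIJ : I < J) {m : ℕ}
    (hm : m ≤ n) (hI : IsWHomogeneous 1 I)
    (hnil : ∀ f ∈ J, ∀ j : Fin n, j.val < m → ∃ N : ℕ, X j ^ N * f ∈ I)
    (hsat : ∀ j : Fin n, j.val = m → ∀ f, X j * f ∈ I → f ∈ I)
    (hfree : ∀ j : Fin n, m < j.val → IsFreeOf j I ∧ IsFreeOf j J) :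
    IsCohenMacaulay n K (IdealQuot J I) ∧
      Module.supportDim (MvPolynomial (Fin n) K) (IdealQuot J I) = (n - m : ℕ) := by
  set rs := (List.ofFn fun t : Fin (n - m) ↦ (⟨m + t, by omega⟩ : Fin n)).map
        (X : Fin n → MvPolynomial (Fin n) K) with hrs
  have hlen : rs.length = n - m := by simp [rs]
  have hmem : ∀ r ∈ rs, r ∈ irrelevant n K := by
    intro r hr
    obtain ⟨j, -, rfl⟩ := List.mem_map.mp hr
    exact Ideal.subset_span ⟨j, rfl⟩
  have hreg : IsRegular (IdealQuot J I) rs := by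
    refine ⟨isWeaklyRegular_idealQuot hIJ.le m hsat hfree, fun htop ↦ ?_⟩
    refine hIJ.not_ge (le_of_le_sup_irrelevant_mul hI fun f hf ↦ ?_)
    have h1 : (Submodule.Quotient.mk ⟨f, hf⟩ : IdealQuot J I) ∈
        (Ideal.ofList rs • ⊤ : Submodule (MvPolynomial (Fin n) K) (IdealQuot J I)) := by
      rw [← htop]; trivial
    rw [mk_mem_smul_top_iff hIJ.le] at h1
    exact sup_le_sup_left (Ideal.mul_mono_left (Ideal.span_le.mpr hmem)) _ h1
  have hdim : Module.supportDim (MvPolynomial (Fin n) K) (IdealQuot J I) = (n - m : ℕ) := by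
    refine le_antisymm (supportDim_idealQuot_le m hnil) ?_
    have := length_le_supportDim_of_isRegular rs _ hreg
    rwa [hlen] at this
  refine ⟨?_, hdim⟩
  rw [IsCohenMacaulay, hdim]
  change _ = (((n - m : ℕ) : ℕ∞) : WithBot ℕ∞)
  rw [WithBot.coe_inj]
  refine le_antisymm (iSup₂_le fun l hl ↦ ?_) ?_
  · have := length_le_supportDim_of_isRegular l _ hl.2
    rw [hdim] at this
    exact WithBot.coe_le_coe.mp this
  · rw [← hlen]
    exact le_iSup₂_of_le (f := fun (rs : List (MvPolynomial (Fin n) K))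
      (_ : (∀ r ∈ rs, r ∈ irrelevant n K) ∧ IsRegular (IdealQuot J I) rs) ↦ (rs.length : ℕ∞))
      rs ⟨hmem, hreg⟩ le_rfl

/-- Sequentially Cohen-Macaulay, with all the quotients of dimension at least `k`. -/
def IsSeqCMFrom (k : ℕ) (I : Ideal (MvPolynomial (Fin n) K)) : Prop :=
  ∃ (r : ℕ) (a : ℕ → Ideal (MvPolynomial (Fin n) K)),
    a 0 = I ∧ a r = ⊤ ∧
    (∀ i ≤ r, IsHomogeneousIdeal (a i)) ∧
    (∀ i < r, a i < a (i + 1)) ∧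
    (∀ i < r, IsCohenMacaulay n K (IdealQuot (a (i + 1)) (a i))) ∧
    (∀ i, i + 1 < r →
      Module.supportDim (MvPolynomial (Fin n) K) (IdealQuot (a (i + 1)) (a i)) <
        Module.supportDim (MvPolynomial (Fin n) K) (IdealQuot (a (i + 2)) (a (i + 1)))) ∧
    (0 < r → (k : WithBot ℕ∞) ≤
      Module.supportDim (MvPolynomial (Fin n) K) (IdealQuot (a 1) (a 0)))

theorem IsSeqCMFrom.isSequentiallyCM {k : ℕ} {I : Ideal (MvPolynomial (Fin n) K)}
    (h : IsSeqCMFrom k I) : IsSequentiallyCM I := by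
  obtain ⟨r, a, h1, h2, h3, h4, h5, h6, -⟩ := h
  exact ⟨r, a, h1, h2, h3, h4, h5, h6⟩

theorem isSeqCMFrom_top (k : ℕ) : IsSeqCMFrom k (⊤ : Ideal (MvPolynomial (Fin n) K)) := by
  refine ⟨0, fun _ ↦ ⊤, rfl, rfl, fun _ _ ↦ ?_, by simp, by simp, by simp, by simp⟩
  exact isHomogeneousIdeal_iff.mpr fun _ _ _ ↦ trivial

/-- The sequence `I, a 0, a 1, …`. -/
def consSeq {α : Type*} (I : α) (a : ℕ → α) : ℕ → α
  | 0 => I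
  | k + 1 => a k

/-- If I = J the step is skipped. Recording a lower bound for the dimensions, instead of the first
dimension itself, keeps them strictly increasing across such skips. -/
theorem IsSeqCMFrom.step {I J : Ideal (MvPolynomial (Fin n) K)} {k : ℕ}
    (h : IsSeqCMFrom (k + 1) J) (hIJ : I ≤ J) (hI : IsHomogeneousIdeal I)
    (hCM : I < J → IsCohenMacaulay n K (IdealQuot J I) ∧
      Module.supportDim (MvPolynomial (Fin n) K) (IdealQuot J I) = k) : IsSeqCMFrom k I := by
  have hk : (k : WithBot ℕ∞) < ((k + 1 : ℕ) : WithBot ℕ∞) := by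
    exact_mod_cast Nat.lt_succ_self k
  obtain ⟨r, a, rfl, h2, h3, h4, h5, h6, h7⟩ := h
  rcases hIJ.eq_or_lt with rfl | hlt
  · exact ⟨r, a, rfl, h2, h3, h4, h5, h6, fun hr ↦ hk.le.trans (h7 hr)⟩
  obtain ⟨hCM, hdim⟩ := hCM hlt
  have hpos (i : ℕ) (hi : i < r + 1) : i = 0 ∨ ∃ t, i = t + 1 ∧ t < r := by
    rcases i with _ | t
    · exact Or.inl rfl
    · exact Or.inr ⟨t, rfl, by omega⟩
  refine ⟨r + 1, consSeq I a, rfl, h2, fun i hi ↦ ?_, fun i hi ↦ ?_, fun i hi ↦ ?_,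
    fun i hi ↦ ?_, fun _ ↦ ?_⟩
  · cases i with
    | zero => exact hI
    | succ t => exact h3 t (by omega)
  · obtain rfl | ⟨t, rfl, ht⟩ := hpos i hi
    · exact hlt
    · exact h4 t ht
  · obtain rfl | ⟨t, rfl, ht⟩ := hpos i hi
    · exact hCM
    · exact h5 t ht
  · obtain rfl | ⟨t, rfl, ht⟩ := hpos i (by omega)
    · have h8 := hk.trans_le (h7 (by omega))
      rw [← hdim] at h8
      exact h8
    · exact h6 t (by omega)
  · exact hdim.ge

end CohenMacaulay

/-! ### Borel sets, initial segments and binomial systems -/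

section Combinatorics

variable {n : ℕ}

/-- The partial sum of the first `k` entries. -/
def partialSum (k : ℕ) (t : Fin n →₀ ℕ) : ℕ := ∑ i with i.val < k, t i

theorem partialSum_add (k : ℕ) (s t : Fin n →₀ ℕ) :
    partialSum k (s + t) = partialSum k s + partialSum k t := by
  simp [partialSum, Finset.sum_add_distrib]

theorem partialSum_zero (t : Fin n →₀ ℕ) : partialSum 0 t = 0 := by simp [partialSum]

theorem partialSum_of_le {k : ℕ} (hk : n ≤ k) (t : Fin n →₀ ℕ) : partialSum k t = ∑ i, t i := by
  rw [partialSum, Finset.filter_true_of_mem fun i _ ↦ i.2.trans_le hk]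

theorem partialSum_le_sum (k : ℕ) (t : Fin n →₀ ℕ) : partialSum k t ≤ ∑ i, t i :=
  Finset.sum_le_sum_of_subset (Finset.filter_subset _ _)

theorem partialSum_mono (k : ℕ) {s t : Fin n →₀ ℕ} (h : s ≤ t) :
    partialSum k s ≤ partialSum k t :=
  Finset.sum_le_sum fun i _ ↦ h i

theorem partialSum_succ (i : Fin n) (t : Fin n →₀ ℕ) :
    partialSum (i + 1) t = partialSum i t + t i := by
  have : (Finset.univ.filter fun j : Fin n ↦ j.val < i.val + 1) =
      insert i (Finset.univ.filter fun j : Fin n ↦ j.val < i.val) := by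
    ext j
    simp only [Finset.mem_filter, Finset.mem_univ, true_and, Finset.mem_insert, Fin.ext_iff]
    omega
  rw [partialSum, this, Finset.sum_insert (by simp), add_comm, partialSum]

theorem partialSum_single (k : ℕ) (j : Fin n) (a : ℕ) :
    partialSum k (Finsupp.single j a) = if j.val < k then a else 0 := by
  simp [partialSum, Finsupp.single_apply, Finset.sum_ite_eq]

theorem borelGE_of_partialSum_le {d : ℕ} {a b : Fin n →₀ ℕ} (ha : a ∈ exponents n d)
    (hb : b ∈ exponents n d) (h : ∀ k, partialSum k b ≤ partialSum k a) : BorelGE a b := by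
  let D : ℕ → ℤ := fun k ↦ (partialSum k a : ℤ) - partialSum k b
  have hD0 : D 0 = 0 := by simp [D, partialSum_zero]
  have hDn : D n = 0 := by
    simp only [D, partialSum_of_le le_rfl]
    rw [show ∑ i, a i = d from ha, show ∑ i, b i = d from hb, sub_self]
  -- Abel summation: the coefficient of e_j - e_{j+1} is the difference of the partial sums through
  -- j. The subtraction in ℕ is harmless by `h`.
  refine ⟨fun j ↦ partialSum (j + 1) a - partialSum (j + 1) b, funext fun i ↦ ?_⟩
  have hcast (j : ℕ) : ((partialSum (j + 1) a - partialSum (j + 1) b : ℕ) : ℤ) = D (j + 1) :=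
    Nat.cast_sub (h _)
  have hi : (a i : ℤ) - b i = D (i + 1) - D i := by
    simp only [D, partialSum_succ]
    push_cast
    ring
  have h1 : ∑ j ∈ Finset.range (n - 1), (if i.val = j then D (j + 1) else 0) = D (i + 1) := by
    rw [Finset.sum_ite_eq]
    split_ifs with hmem
    · rfl
    · rw [Finset.mem_range] at hmem
      rw [show i.val + 1 = n by omega, hDn]
  have h2 : ∑ j ∈ Finset.range (n - 1), (if i.val = j + 1 then D (j + 1) else 0) = D i := by
    rcases hiv : i.val with _ | t
    · simp [hD0]
    · have : ∀ j, (t + 1 = j + 1) = (t = j) := fun j ↦ by simp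
      simp only [this]
      rw [Finset.sum_ite_eq, if_pos (Finset.mem_range.mpr (by omega))]
  rw [hi]
  simp only [hcast, Finset.sum_apply, Pi.smul_apply, Pi.sub_apply, Pi.single_apply, smul_eq_mul,
    Fin.ext_iff]
  rw [Fin.sum_univ_eq_sum_range
    (fun j ↦ D (j + 1) * ((if i.val = j then 1 else 0) - if i.val = j + 1 then 1 else 0)) (n - 1)]
  rw [← h1, ← h2, ← Finset.sum_sub_distrib]
  refine Finset.sum_congr rfl fun j _ ↦ ?_
  split_ifs <;> simp_all

/-- The exponents of the multiples of the monomials with exponents in `B`. -/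
def multiples (B : Set (Fin n →₀ ℕ)) : Set (Fin n →₀ ℕ) := {b | ∃ v ∈ B, v ≤ b}

theorem multiples_mono {B B' : Set (Fin n →₀ ℕ)} (h : B ⊆ B') : multiples B ⊆ multiples B' :=
  fun _ ⟨v, hv, hvb⟩ ↦ ⟨v, h hv, hvb⟩

theorem multiples_union {B B' : Set (Fin n →₀ ℕ)} :
    multiples (B ∪ B') = multiples B ∪ multiples B' := by
  ext b
  simp [multiples, or_and_right, exists_or]

theorem mem_multiples_of_le {B : Set (Fin n →₀ ℕ)} {s t : Fin n →₀ ℕ} (hs : s ∈ multiples B)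
    (hst : s ≤ t) : t ∈ multiples B :=
  let ⟨v, hv, hvs⟩ := hs
  ⟨v, hv, hvs.trans hst⟩

/-- `X^u` is an initial segment of the word `X^b`, whose letters are ordered by their index. -/
def IsInitial (u b : Fin n →₀ ℕ) : Prop :=
  u ≤ b ∧ ∀ i j, i < j → 0 < u j → u i = b i

theorem exists_isInitial {d : ℕ} {b : Fin n →₀ ℕ} (h : d ≤ ∑ i, b i) :
    ∃ u, IsInitial u b ∧ u ∈ exponents n d := by
  induction h using Nat.decreasingInduction with
  | self => exact ⟨b, ⟨le_rfl, fun _ _ _ _ ↦ rfl⟩, rfl⟩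
  | of_succ d _ ih =>
    obtain ⟨u, ⟨hle, hu⟩, hud⟩ := ih
    have hne : (Finset.univ.filter fun i ↦ 0 < u i).Nonempty := by
      by_contra hcon
      have h0 : ∑ i, u i = 0 := Finset.sum_eq_zero fun i _ ↦ by
        by_contra hi
        exact hcon ⟨i, by simpa using Nat.pos_of_ne_zero hi⟩
      have : ∑ i, u i = d + 1 := hud
      omega
    -- Removing the last letter of an initial segment leaves an initial segment.
    obtain ⟨j, hj, hmax⟩ := Finset.exists_max_image _ id hne
    have hj0 : 0 < u j := by simpa using hj
    have hsum : u - Finsupp.single j 1 + Finsupp.single j 1 = u :=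
      tsub_add_cancel_of_le (Finsupp.single_le_iff.mpr hj0)
    refine ⟨u - Finsupp.single j 1, ⟨tsub_le_self.trans hle, fun i k hik hk ↦ ?_⟩, ?_⟩
    · have hk' : 0 < u k := hk.trans_le (by simp)
      have hkj : k ≤ j := hmax k (by simpa using hk')
      rw [Finsupp.tsub_apply, Finsupp.single_eq_of_ne (hik.trans_le hkj).ne, tsub_zero]
      exact hu i k hik hk'
    · have h1 : ∑ i, u i = d + 1 := hud
      rw [← hsum] at h1
      simp only [Finsupp.add_apply, Finset.sum_add_distrib] at h1
      have h2 : ∑ i, (Finsupp.single j 1 : Fin n →₀ ℕ) i = 1 := by simp [Finsupp.single_apply]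
      rw [h2] at h1
      exact Nat.succ_injective h1

/-- The initial segments of degree `d` of the multiples of a Borel set belong to it. -/
theorem IsBorelSet.isInitial_mem {d : ℕ} {B : Set (Fin n →₀ ℕ)} (hB : IsBorelSet d B)
    {t t' u : Fin n →₀ ℕ} (ht : t ∈ multiples B) (hdom : ∀ k, partialSum k t ≤ partialSum k t')
    (hu : IsInitial u t') (hud : u ∈ exponents n d) : u ∈ B := by
  obtain ⟨v, hv, hvt⟩ := ht
  have hvd := hB.1 hv
  refine hB.2 v hvd u hud hv (borelGE_of_partialSum_le hud hvd fun k ↦ ?_)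
  -- If u has a letter of index at least k, it agrees with t' in the first k entries; otherwise its
  -- whole degree d lies there, the largest value possible.
  by_cases hk : ∃ j : Fin n, k ≤ j.val ∧ 0 < u j
  · obtain ⟨j, hkj, hj⟩ := hk
    have : partialSum k u = partialSum k t' := by
      refine Finset.sum_congr rfl fun i hi ↦ hu.2 i j ?_ hj
      have hi := (Finset.mem_filter.mp hi).2
      rw [Fin.lt_def]
      omega
    rw [this]
    exact (partialSum_mono k hvt).trans (hdom k)
  · push Not at hk
    have : partialSum k u = ∑ i, u i := by
      refine Finset.sum_subset (Finset.filter_subset _ _) fun i _ hi ↦ ?_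
      have := hk i (by simpa using hi)
      omega
    rw [this, show ∑ i, u i = d from hud, ← show ∑ i, v i = d from hvd]
    exact partialSum_le_sum k v

theorem sum_le_of_mem_multiples {d : ℕ} {B : Set (Fin n →₀ ℕ)} (hB : B ⊆ exponents n d)
    {t : Fin n →₀ ℕ} (ht : t ∈ multiples B) : d ≤ ∑ i, t i := by
  obtain ⟨v, hv, hvt⟩ := ht
  rw [← show ∑ i, v i = d from hB hv]
  exact Finset.sum_le_sum fun i _ ↦ hvt i

theorem IsBorelSet.mem_multiples {d : ℕ} {B : Set (Fin n →₀ ℕ)} (hB : IsBorelSet d B)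
    {t t' : Fin n →₀ ℕ} (ht : t ∈ multiples B)
    (hdom : ∀ k, partialSum k t ≤ partialSum k t') : t' ∈ multiples B := by
  have h1 := (sum_le_of_mem_multiples hB.1 ht).trans (by simpa [partialSum_of_le] using hdom n)
  obtain ⟨u, hu, hud⟩ := exists_isInitial h1
  exact ⟨u, hB.isInitial_mem ht hdom hu hud, hu.1⟩

theorem IsBorelSet.union {d : ℕ} {B B' : Set (Fin n →₀ ℕ)} (hB : IsBorelSet d B)
    (hB' : IsBorelSet d B') : IsBorelSet d (B ∪ B') := by
  refine ⟨Set.union_subset hB.1 hB'.1, ?_⟩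
  rintro a ha b hb (h | h) hab
  · exact Or.inl (hB.2 a ha b hb h hab)
  · exact Or.inr (hB'.2 a ha b hb h hab)

theorem IsTranslate.neg {ρ : Fin n → ℤ} {b c : Fin n →₀ ℕ} (h : IsTranslate ρ c b) :
    IsTranslate (-ρ) b c := fun i ↦ by
  have := h i
  simp only [Pi.neg_apply]
  omega

theorem isTranslate_neg_iff {ρ : Fin n → ℤ} {b c : Fin n →₀ ℕ} :
    IsTranslate (-ρ) b c ↔ IsTranslate ρ c b :=
  ⟨fun h ↦ by simpa using h.neg, IsTranslate.neg⟩

theorem IsTranslate.left_unique {ρ : Fin n → ℤ} {b c c' : Fin n →₀ ℕ} (h : IsTranslate ρ c b)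
    (h' : IsTranslate ρ c' b) : c = c' := by
  ext i
  have := h i
  have := h' i
  omega

namespace IsBinomialSystem

variable {d : ℕ} {A C : Set (Fin n →₀ ℕ)} {ρ : Fin n → ℤ}

theorem shiftSet_subset (h : IsBinomialSystem n d A C ρ) : shiftSet C ρ ⊆ exponents n d :=
  fun _ hb ↦ h.borel_right.1 (Or.inr hb)

theorem borel_inter (h : IsBinomialSystem n d A C ρ) : IsBorelSet d A := by
  refine ⟨h.A_subset, fun a ha b hb haA hab ↦ ?_⟩
  rcases h.borel_left.2 a ha b hb (Or.inl haA) hab with h1 | h1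
  · exact h1
  rcases h.borel_right.2 a ha b hb (Or.inl haA) hab with h2 | h2
  · exact h2
  exact (Set.eq_empty_iff_forall_notMem.mp h.C_inter_shift b ⟨h1, h2⟩).elim

theorem borel_union (h : IsBinomialSystem n d A C ρ) : IsBorelSet d (A ∪ C ∪ (A ∪ shiftSet C ρ)) :=
  h.borel_left.union h.borel_right

theorem shiftSet_shiftSet_neg (h : IsBinomialSystem n d A C ρ) :
    shiftSet (shiftSet C ρ) (-ρ) = C := by
  ext c
  constructor
  · rintro ⟨b, ⟨c', hc', hb⟩, hc⟩
    rwa [← hb.left_unique (isTranslate_neg_iff.mp hc)]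
  · intro hc
    obtain ⟨b, -, hb⟩ := h.shift_subset c hc
    exact ⟨b, ⟨c, hc, hb⟩, hb.neg⟩

theorem neg (h : IsBinomialSystem n d A C ρ) : IsBinomialSystem n d A (shiftSet C ρ) (-ρ) where
  A_subset := h.A_subset
  C_subset := h.shiftSet_subset
  shift_subset := by
    rintro b ⟨c, hc, hb⟩
    exact ⟨c, h.C_subset hc, hb.neg⟩
  A_inter_C := h.A_inter_shift
  A_inter_shift := by rw [h.shiftSet_shiftSet_neg, h.A_inter_C]
  C_inter_shift := by rw [h.shiftSet_shiftSet_neg, Set.inter_comm, h.C_inter_shift]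
  borel_left := h.borel_right
  borel_right := by rw [h.shiftSet_shiftSet_neg]; exact h.borel_left

/-- The initial segment of b of degree d lies in both A ∪ C and A ∪ (C+ρ), hence in A. -/
theorem multiples_inter (h : IsBinomialSystem n d A C ρ) {b : Fin n →₀ ℕ}
    (hC : b ∈ multiples C) (hC' : b ∈ multiples (shiftSet C ρ)) : b ∈ multiples A := by
  obtain ⟨u, hu, hud⟩ := exists_isInitial (sum_le_of_mem_multiples h.C_subset hC)
  have h1 := h.borel_left.isInitial_mem (multiples_mono Set.subset_union_right hC)
    (fun _ ↦ le_rfl) hu hud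
  have h2 := h.borel_right.isInitial_mem (multiples_mono Set.subset_union_right hC')
    (fun _ ↦ le_rfl) hu hud
  rcases h1 with h1 | h1
  · exact ⟨u, h1, hu.1⟩
  rcases h2 with h2 | h2
  · exact ⟨u, h2, hu.1⟩
  exact (Set.eq_empty_iff_forall_notMem.mp h.C_inter_shift u ⟨h1, h2⟩).elim

/-- For the reverse lexicographic order, a translation by `ρ` with positive last nonzero entry
does not leave the ideal generated by `X^A`. -/
theorem translate_mem_multiples (h : IsBinomialSystem n d A C ρ) {L : Fin n} (hL : 0 < ρ L)
    (hL' : ∀ j, L < j → ρ j = 0) {b b' : Fin n →₀ ℕ} (hbb' : IsTranslate ρ b b')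
    (hC : b ∈ multiples C) (hA : b ∈ multiples A) : b' ∈ multiples A := by
  have hb' : b' ∈ multiples (shiftSet C ρ) := by
    obtain ⟨c, hc, hcb⟩ := hC
    obtain ⟨c', -, hc'⟩ := h.shift_subset c hc
    refine ⟨c', ⟨c, hc, hc'⟩, fun i ↦ ?_⟩
    have h1 := hc' i
    have h2 := hbb' i
    have h3 := hcb i
    omega
  obtain ⟨u, hu, hud⟩ := exists_isInitial (sum_le_of_mem_multiples h.shiftSet_subset hb')
  rcases h.borel_right.isInitial_mem (multiples_mono Set.subset_union_right hb')
    (fun _ ↦ le_rfl) hu hud with h1 | ⟨v, hv, hvu⟩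
  · exact ⟨u, h1, hu.1⟩
  have hvA : v ∈ A := by
    -- Here u = v + ρ with v ∈ C. It is shown that v is an initial segment of b, which puts it in A
    -- as well.
    refine h.borel_inter.isInitial_mem hA (fun _ ↦ le_rfl) ⟨fun i ↦ ?_, fun i j hij hj ↦ ?_⟩
      (h.C_subset hv)
    · have h1 := hvu i
      have h2 := hbb' i
      have h3 := hu.1 i
      omega
    · have key : u i = b' i := by
        -- For i < L, the letter L witnesses agreement, since u_L = v_L + ρ_L > 0. For i ≥ L, the
        -- letter j > L does, since ρ_j = 0 gives u_j = v_j > 0.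
        rcases lt_or_ge i L with hi | hi
        · refine hu.2 i L hi ?_
          have := hvu L
          omega
        · refine hu.2 i j hij ?_
          have h1 := hvu j
          rw [hL' j (hi.trans_lt hij)] at h1
          omega
      have h1 := hvu i
      have h2 := hbb' i
      omega
  exact (Set.eq_empty_iff_forall_notMem.mp h.A_inter_C v ⟨hvA, hv⟩).elim

/-- Replacing the letters X_L one by one by X_j is a Borel move inside A ∪ (C+ρ). Once no X_L is
left the exponent must be in A, as elements of C+ρ have L-th entry at least ρ_L > 0. -/
theorem single_add_mem_multiples (h : IsBinomialSystem n d A C ρ) {L : Fin n} (hL : 0 < ρ L)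
    {j : Fin n} (hj : j < L) {b : Fin n →₀ ℕ} (hb : b ∈ A ∪ shiftSet C ρ) :
    Finsupp.single j (b L) + b ∈ multiples A := by
  induction hk : b L generalizing b with
  | zero =>
    rcases hb with hb | ⟨c, hc, hcb⟩
    · exact ⟨b, hb, by simp⟩
    · have := hcb L
      omega
  | succ k ih =>
    have hle : Finsupp.single L 1 ≤ b := by
      rw [Finsupp.single_le_iff]
      omega
    obtain ⟨e, rfl⟩ := exists_add_of_le hle
    have hd := h.borel_right.1 hb
    have hsingle (i : Fin n) : ∑ x, (Finsupp.single i 1 : Fin n →₀ ℕ) x = 1 := by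
      simp [Finsupp.single_apply]
    have hd' : Finsupp.single j 1 + e ∈ exponents n d := by
      have : ∑ i, (Finsupp.single L 1 + e : Fin n →₀ ℕ) i = d := hd
      change ∑ i, (Finsupp.single j 1 + e : Fin n →₀ ℕ) i = d
      simpa [Finset.sum_add_distrib, hsingle] using this
    have hmem : Finsupp.single j 1 + e ∈ A ∪ shiftSet C ρ := by
      refine h.borel_right.2 _ hd _ hd' hb (borelGE_of_partialSum_le hd' hd fun k ↦ ?_)
      rw [partialSum_add, partialSum_add, partialSum_single, partialSum_single]
      have := Fin.lt_def.mp hj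
      split_ifs <;> omega
    have := ih hmem (by simpa [hj.ne, add_comm 1] using hk)
    refine mem_multiples_of_le this ?_
    rw [Finsupp.single_add, add_assoc]
    gcongr
    exact le_add_self

end IsBinomialSystem

end Combinatorics

/-! ### Monomial ideals and saturations by tails of the variables -/

section Ideals

variable {n : ℕ} {K : Type*} [Field K]

theorem monomialMap_apply (g : (Fin n →₀ ℕ) → MvPolynomial (Fin n) K) (f : MvPolynomial (Fin n) K) :
    monomialMap g f = ∑ s ∈ f.support, coeff s f • g s := by
  conv_lhs => rw [f.as_sum]
  rw [map_sum]
  refine Finset.sum_congr rfl fun s _ ↦ ?_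
  rw [← monomialMap_monomial g s, ← map_smul, smul_monomial, smul_eq_mul, mul_one]

theorem monomialMap_congr {g g' : (Fin n →₀ ℕ) → MvPolynomial (Fin n) K}
    {f : MvPolynomial (Fin n) K} (h : ∀ s ∈ f.support, g s = g' s) :
    monomialMap g f = monomialMap g' f := by
  rw [monomialMap_apply, monomialMap_apply]
  exact Finset.sum_congr rfl fun s hs ↦ by rw [h s hs]

theorem monomialMap_id (f : MvPolynomial (Fin n) K) :
    monomialMap (fun s ↦ monomial s 1) f = f := by
  refine LinearMap.congr_fun (g := LinearMap.id) (linearMap_ext_monomial fun s ↦ ?_) f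
  simp

theorem map_mem_of_forall_monomial (φ : MvPolynomial (Fin n) K →ₗ[K] MvPolynomial (Fin n) K)
    (J : Ideal (MvPolynomial (Fin n) K)) (h : ∀ s, φ (monomial s 1) ∈ J)
    (f : MvPolynomial (Fin n) K) : φ f ∈ J := by
  rw [f.as_sum, map_sum]
  refine J.sum_mem fun s _ ↦ ?_
  rw [← mul_one (coeff s f), ← smul_eq_mul, ← smul_monomial, map_smul]
  exact Submodule.smul_of_tower_mem J _ (h s)

theorem mem_span_monomials {B : Set (Fin n →₀ ℕ)} {f : MvPolynomial (Fin n) K} :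
    f ∈ Ideal.span (monomials K B) ↔ ∀ s ∈ f.support, s ∈ multiples B := by
  have : monomials K B = (fun s ↦ monomial s (1 : K)) '' B := by
    ext f
    simp [monomials, eq_comm]
  rw [this, mem_ideal_span_monomial_image]
  rfl

theorem monomial_mem_span_monomials {B : Set (Fin n →₀ ℕ)} {s : Fin n →₀ ℕ} :
    monomial s (1 : K) ∈ Ideal.span (monomials K B) ↔ s ∈ multiples B := by
  classical
  rw [mem_span_monomials, support_monomial, if_neg one_ne_zero]
  simp

theorem monomial_mul_mem_span_monomials {B : Set (Fin n →₀ ℕ)} {t : Fin n →₀ ℕ}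
    {f : MvPolynomial (Fin n) K} :
    monomial t 1 * f ∈ Ideal.span (monomials K B) ↔ ∀ s ∈ f.support, t + s ∈ multiples B := by
  rw [mem_span_monomials]
  constructor
  · intro h s hs
    refine h _ ?_
    rw [mem_support_iff, coeff_monomial_mul, one_mul]
    exact mem_support_iff.mp hs
  · intro h s hs
    rw [mem_support_iff, coeff_monomial_mul'] at hs
    split_ifs at hs with hts
    · obtain ⟨r, rfl⟩ := exists_add_of_le hts
      exact h r (mem_support_iff.mpr (by simpa using hs))
    · exact (hs rfl).elim

theorem isWHomogeneous_span_monomials (w : Fin n → ℕ) (B : Set (Fin n →₀ ℕ)) :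
    IsWHomogeneous w (Ideal.span (monomials K B)) := by
  refine isWHomogeneous_span ?_
  rintro _ ⟨b, -, rfl⟩
  exact ⟨_, isWeightedHomogeneous_monomial w b 1 rfl⟩

theorem isWHomogeneous_F {w : Fin n → ℕ} {A C : Set (Fin n →₀ ℕ)} {ρ : Fin n → ℤ}
    (h : ∀ c ∈ C, ∀ b, IsTranslate ρ c b → Finsupp.weight w b = Finsupp.weight w c) :
    IsWHomogeneous w (F K A C ρ) := by
  refine isWHomogeneous_span ?_
  rintro _ (⟨b, -, rfl⟩ | ⟨c, hc, b, hcb, rfl⟩)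
  · exact ⟨_, isWeightedHomogeneous_monomial w b 1 rfl⟩
  · exact ⟨_, (weightedHomogeneousSubmodule K w _).sub_mem
      (isWeightedHomogeneous_monomial w c 1 rfl)
      (isWeightedHomogeneous_monomial w b 1 (h c hc b hcb))⟩

/-- The ideal of the elements multiplied into `I` by a power of `x`. -/
def satBy {R : Type*} [CommRing R] (x : R) (I : Ideal R) : Ideal R where
  carrier := {f | ∃ N : ℕ, x ^ N * f ∈ I}
  zero_mem' := ⟨0, by simp⟩
  add_mem' := by
    rintro f g ⟨N, hN⟩ ⟨M, hM⟩
    refine ⟨N + M, ?_⟩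
    rw [mul_add]
    refine I.add_mem ?_ ?_
    · rw [pow_add, mul_right_comm]
      exact I.mul_mem_right _ hN
    · rw [pow_add, mul_assoc]
      exact I.mul_mem_left _ hM
  smul_mem' := by
    rintro c f ⟨N, hN⟩
    exact ⟨N, by rw [smul_eq_mul, mul_left_comm]; exact I.mul_mem_left _ hN⟩

theorem mem_satBy {R : Type*} [CommRing R] {x f : R} {I : Ideal R} :
    f ∈ satBy x I ↔ ∃ N : ℕ, x ^ N * f ∈ I := Iff.rfl

theorem le_satBy {R : Type*} [CommRing R] (x : R) (I : Ideal R) : I ≤ satBy x I :=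
  fun _ hf ↦ ⟨0, by simpa using hf⟩

theorem satBy_mono {R : Type*} [CommRing R] {x y : R} {I J : Ideal R} (hxy : x ∣ y) (hIJ : I ≤ J) :
    satBy x I ≤ satBy y J := by
  rintro f ⟨N, hN⟩
  obtain ⟨z, hz⟩ := pow_dvd_pow_of_dvd hxy N
  exact ⟨N, hIJ (by rw [hz, mul_right_comm]; exact I.mul_mem_right _ hN)⟩

theorem satBy_one {R : Type*} [CommRing R] (I : Ideal R) : satBy 1 I = I := by
  ext f
  simp [mem_satBy]

theorem mem_satBy_of_mul_mem {R : Type*} [CommRing R] {x y f : R} {I : Ideal R} (hxy : x ∣ y)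
    (h : x * f ∈ satBy y I) : f ∈ satBy y I := by
  obtain ⟨N, hN⟩ := h
  obtain ⟨z, rfl⟩ := hxy
  refine ⟨N + 1, ?_⟩
  rw [show (x * z) ^ (N + 1) * f = z * ((x * z) ^ N * (x * f)) by ring]
  exact I.mul_mem_left _ hN

theorem mem_satBy_of_pow_mul_mem {R : Type*} [CommRing R] {x y f : R} {I : Ideal R} (hxy : x ∣ y)
    (k : ℕ) (h : x ^ k * f ∈ satBy y I) : f ∈ satBy y I := by
  induction k with
  | zero => simpa using h
  | succ k ih => exact ih (mem_satBy_of_mul_mem hxy (by rwa [← mul_assoc, ← pow_succ']))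

/-- The exponent of `X_m ⋯ X_{n-1}`. -/
noncomputable def tailExp (n m : ℕ) : Fin n →₀ ℕ :=
  Finsupp.equivFunOnFinite.symm fun i ↦ if m ≤ i.val then 1 else 0

@[simp] theorem tailExp_apply (m : ℕ) (i : Fin n) :
    tailExp n m i = if m ≤ i.val then 1 else 0 := rfl

theorem tailExp_self : tailExp n n = 0 := by
  ext i
  simp

/-- The saturation with respect to `X_m ⋯ X_{n-1}`. -/
noncomputable def tailSat (m : ℕ) (I : Ideal (MvPolynomial (Fin n) K)) :
    Ideal (MvPolynomial (Fin n) K) :=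
  satBy (monomial (tailExp n m) 1) I

theorem tailSat_self (I : Ideal (MvPolynomial (Fin n) K)) : tailSat n I = I := by
  rw [tailSat, tailExp_self, ← one_def, satBy_one]

theorem monomial_dvd_monomial_of_le {s t : Fin n →₀ ℕ} (h : s ≤ t) :
    monomial s (1 : K) ∣ monomial t 1 := by
  obtain ⟨r, rfl⟩ := exists_add_of_le h
  exact ⟨monomial r 1, by simp [monomial_mul]⟩

theorem tailSat_mono (m : ℕ) {I J : Ideal (MvPolynomial (Fin n) K)} (h : I ≤ J) :
    tailSat (m + 1) I ≤ tailSat m J := by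
  refine satBy_mono (monomial_dvd_monomial_of_le fun i ↦ ?_) h
  simp only [tailExp_apply]
  split_ifs <;> omega

theorem X_dvd_tail {m : ℕ} {j : Fin n} (hj : m ≤ j.val) :
    (X j : MvPolynomial (Fin n) K) ∣ monomial (tailExp n m) 1 := by
  refine monomial_dvd_monomial_of_le (Finsupp.single_le_iff.mpr ?_)
  simp [hj]

theorem mem_tailSat_of_X_mul_mem {m : ℕ} {j : Fin n} (hj : m ≤ j.val)
    {I : Ideal (MvPolynomial (Fin n) K)} {f : MvPolynomial (Fin n) K}
    (h : X j * f ∈ tailSat m I) : f ∈ tailSat m I :=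
  mem_satBy_of_mul_mem (X_dvd_tail hj) h

theorem IsWHomogeneous.tailSat {w : Fin n → ℕ} {I : Ideal (MvPolynomial (Fin n) K)}
    (hI : IsWHomogeneous w I) (m : ℕ) : IsWHomogeneous w (tailSat m I) := by
  rintro f ⟨N, hN⟩ k
  refine ⟨N, ?_⟩
  rw [monomial_pow, one_pow] at hN ⊢
  rw [← weightedHomogeneousComponent_monomial_mul]
  exact hI _ hN _

/-- Homogeneity in X_j puts X_j^k times the k-th coefficient into the saturation, where X_j can be
cancelled. -/
theorem isFreeOf_tailSat {m : ℕ} {j : Fin n} (hj : m ≤ j.val)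
    {I : Ideal (MvPolynomial (Fin n) K)} (hI : IsWHomogeneous (Pi.single j 1) I) :
    IsFreeOf j (tailSat m I) := by
  intro f hf k
  refine mem_satBy_of_pow_mul_mem (X_dvd_tail hj) k ?_
  rw [X_pow_mul_coeffVar]
  exact hI.tailSat m f hf k

theorem saturation_eq_tailSat (hn : 0 < n) {I : Ideal (MvPolynomial (Fin n) K)}
    (h : ∀ f ∈ tailSat (n - 1) I, ∀ j : Fin n, ∃ N : ℕ, X j ^ N * f ∈ I) :
    saturation I = tailSat (n - 1) I := by
  have htail : tailExp n (n - 1) = Finsupp.single ⟨n - 1, by omega⟩ 1 := by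
    ext i
    rw [tailExp_apply, Finsupp.single_apply]
    congr 1
    rw [Fin.ext_iff]
    simp only [eq_iff_iff]
    omega
  refine le_antisymm (iSup_le fun k f hf ↦ ?_) fun f hf ↦ ?_
  · have hX : (X ⟨n - 1, by omega⟩ : MvPolynomial (Fin n) K) ∈ irrelevant n K :=
      Ideal.subset_span ⟨_, rfl⟩
    have h1 := Submodule.mem_colon.mp hf _ (Ideal.pow_mem_pow hX k)
    rw [smul_eq_mul, mul_comm] at h1
    rw [tailSat, htail]
    exact ⟨k, h1⟩
  -- Every variable lies in the radical of (I : f); as S₊ is finitely generated, some S₊^k lies in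
  -- (I : f).
  · have hle : irrelevant n K ≤
        (Submodule.colon I ({f} : Set (MvPolynomial (Fin n) K))).radical := by
      refine Ideal.span_le.mpr ?_
      rintro _ ⟨j, rfl⟩
      obtain ⟨N, hN⟩ := h f hf j
      exact ⟨N, Submodule.mem_colon_singleton.mpr hN⟩
    obtain ⟨k, hk⟩ := Ideal.exists_pow_le_of_le_radical_of_fg hle
      (IsNoetherian.noetherian _)
    refine Submodule.mem_iSup_of_mem k (Submodule.mem_colon.mpr fun p hp ↦ ?_)
    have := Submodule.mem_colon_singleton.mp (hk hp)
    rwa [smul_eq_mul, mul_comm] at this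

theorem partialSum_nsmul_tailExp_le (N k m : ℕ) {j : Fin n} (hj : j.val ≤ m) :
    partialSum k (N • tailExp n m) ≤ partialSum k (Finsupp.single j (N * n)) := by
  rw [partialSum_single]
  split_ifs with hk
  · refine (partialSum_le_sum _ _).trans ?_
    calc ∑ i, (N • tailExp n m) i ≤ ∑ _i : Fin n, N := Finset.sum_le_sum fun i _ ↦ by
          rw [Finsupp.smul_apply, tailExp_apply]
          split_ifs <;> simp
      _ = N * n := by simp [mul_comm]
  · refine (Finset.sum_eq_zero fun i hi ↦ ?_).le
    have := (Finset.mem_filter.mp hi).2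
    rw [Finsupp.smul_apply, tailExp_apply, if_neg (by omega), smul_zero]

/-- The N-th power of the tail has degree at most N n and only letters of index at least m ≥ j, so
X_j^(N n) dominates it in all partial sums. -/
theorem X_pow_mul_mem_of_tail_mul_mem {d : ℕ} {B : Set (Fin n →₀ ℕ)} (hB : IsBorelSet d B)
    {m N : ℕ} {j : Fin n} (hj : j.val ≤ m) {f : MvPolynomial (Fin n) K}
    (h : monomial (tailExp n m) 1 ^ N * f ∈ Ideal.span (monomials K B)) :
    X j ^ (N * n) * f ∈ Ideal.span (monomials K B) := by
  rw [monomial_pow, one_pow, monomial_mul_mem_span_monomials] at h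
  rw [X_pow_eq_monomial, monomial_mul_mem_span_monomials]
  intro s hs
  refine hB.mem_multiples (h s hs) fun k ↦ ?_
  rw [partialSum_add, partialSum_add]
  exact Nat.add_le_add_right (partialSum_nsmul_tailExp_le N k m hj) _

/-- The ideals I and J differ only where the chain passes from F to the monomial ideal. -/
theorem isSeqCMFrom_tailSat_step {I J : Ideal (MvPolynomial (Fin n) K)} {m : ℕ} (hm : m < n)
    (h : IsSeqCMFrom (n - m) (tailSat m J)) (hIJ : I ≤ J) (hI : IsWHomogeneous 1 I)
    (hnil : ∀ f ∈ tailSat m J, ∀ j : Fin n, j.val ≤ m → ∃ N : ℕ, X j ^ N * f ∈ tailSat (m + 1) I)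
    (hfree : ∀ j : Fin n, m + 1 < j.val → IsWHomogeneous (Pi.single j 1) I ∧
      IsWHomogeneous (Pi.single j 1) J) :
    IsSeqCMFrom (n - (m + 1)) (tailSat (m + 1) I) := by
  rw [show n - m = n - (m + 1) + 1 by omega] at h
  refine h.step (tailSat_mono m hIJ) (isHomogeneousIdeal_iff.mpr (hI.tailSat _)) fun hlt ↦ ?_
  exact isCohenMacaulay_idealQuot hlt hm (hI.tailSat _)
    (fun f hf j hj ↦ hnil f hf j (by omega))
    (fun j hj f hf ↦ mem_tailSat_of_X_mul_mem hj.ge hf)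
    fun j hj ↦ ⟨isFreeOf_tailSat hj.le (hfree j hj).1, isFreeOf_tailSat (by omega) (hfree j hj).2⟩

theorem isSeqCMFrom_tailSat_monomials {d : ℕ} {B : Set (Fin n →₀ ℕ)} (hB : IsBorelSet d B)
    {m : ℕ} (hm : m ≤ n) : IsSeqCMFrom (n - m) (tailSat m (Ideal.span (monomials K B))) := by
  induction m with
  | zero =>
    refine (isSeqCMFrom_top _).step le_top
      (isHomogeneousIdeal_iff.mpr ((isWHomogeneous_span_monomials _ B).tailSat _)) fun hlt ↦ ?_
    exact isCohenMacaulay_idealQuot hlt (Nat.zero_le n)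
      ((isWHomogeneous_span_monomials _ B).tailSat _)
      (fun f _ j hj ↦ absurd hj (Nat.not_lt_zero _))
      (fun j hj f hf ↦ mem_tailSat_of_X_mul_mem hj.ge hf)
      fun j hj ↦ ⟨isFreeOf_tailSat hj.le (isWHomogeneous_span_monomials _ B), IsFreeOf.top j⟩
  | succ m ih =>
    refine isSeqCMFrom_tailSat_step hm (ih (by omega)) le_rfl (isWHomogeneous_span_monomials _ B)
      (fun f hf j hj ↦ ?_)
      fun j _ ↦ ⟨isWHomogeneous_span_monomials _ B, isWHomogeneous_span_monomials _ B⟩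
    obtain ⟨N, hN⟩ := hf
    exact ⟨N * n, le_satBy _ _ (X_pow_mul_mem_of_tail_mul_mem hB hj hN)⟩

end Ideals

/-! ### The ideal of a binomial system -/

section Binomial

variable {n d : ℕ} {K : Type*} [Field K] {A C : Set (Fin n →₀ ℕ)} {ρ : Fin n → ℤ}

theorem span_monomials_le_F : Ideal.span (monomials K A) ≤ F K A C ρ :=
  Ideal.span_mono Set.subset_union_left

theorem F_empty : F K A ∅ ρ = Ideal.span (monomials K A) := by
  have : binomials K (∅ : Set (Fin n →₀ ℕ)) ρ = ∅ := by
    ext f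
    simp [binomials]
  rw [F, this, Set.union_empty]

theorem F_le :
    F K A C ρ ≤ Ideal.span (monomials K (A ∪ C ∪ (A ∪ shiftSet C ρ))) := by
  refine Ideal.span_le.mpr ?_
  rintro _ (⟨b, hb, rfl⟩ | ⟨c, hc, b, hb, rfl⟩)
  · exact Ideal.subset_span ⟨b, Or.inl (Or.inl hb), rfl⟩
  · exact Ideal.sub_mem _ (Ideal.subset_span ⟨c, Or.inl (Or.inr hc), rfl⟩)
      (Ideal.subset_span ⟨b, Or.inr (Or.inr ⟨c, hc, hb⟩), rfl⟩)

theorem F_neg : F K A (shiftSet C ρ) (-ρ) = F K A C ρ := by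
  refine le_antisymm (Ideal.span_le.mpr ?_) (Ideal.span_le.mpr ?_)
  · rintro _ (hf | ⟨b, ⟨c, hc, hb⟩, c', hc', rfl⟩)
    · exact Ideal.subset_span (Or.inl hf)
    · obtain rfl := hb.left_unique (isTranslate_neg_iff.mp hc')
      rw [← neg_sub]
      exact Ideal.neg_mem_iff _ |>.mpr (Ideal.subset_span (Or.inr ⟨c, hc, b, hb, rfl⟩))
  · rintro _ (hf | ⟨c, hc, b, hb, rfl⟩)
    · exact Ideal.subset_span (Or.inl hf)
    · rw [← neg_sub]
      exact Ideal.neg_mem_iff _ |>.mpr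
        (Ideal.subset_span (Or.inr ⟨b, ⟨c, hc, hb⟩, c, hb.neg, rfl⟩))

/-- The vector `b + ρ`, if it has nonnegative entries. -/
noncomputable def translate (ρ : Fin n → ℤ) (b : Fin n →₀ ℕ) : Fin n →₀ ℕ :=
  Finsupp.equivFunOnFinite.symm fun i ↦ ((b i : ℤ) + ρ i).toNat

theorem IsTranslate.translate_eq {b b' : Fin n →₀ ℕ} (h : IsTranslate ρ b b') :
    translate ρ b = b' := by
  ext i
  have := h i
  simp only [translate, Finsupp.equivFunOnFinite_symm_apply_apply]
  omega

theorem IsTranslate.add {b b' : Fin n →₀ ℕ} (h : IsTranslate ρ b b') (s : Fin n →₀ ℕ) :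
    IsTranslate ρ (s + b) (s + b') := fun i ↦ by
  have := h i
  simp only [Finsupp.add_apply]
  omega

open Classical in
/-- Multiplication by `X^ρ` of the multiples of `X^C` outside of the ideal generated by `X^A`. -/
noncomputable def shiftMap (K : Type*) [Field K] (A C : Set (Fin n →₀ ℕ)) (ρ : Fin n → ℤ) :
    MvPolynomial (Fin n) K →ₗ[K] MvPolynomial (Fin n) K :=
  monomialMap fun b ↦
    if b ∈ multiples C ∧ b ∉ multiples A then monomial (translate ρ b) 1 else monomial b 1

theorem shiftMap_monomial_of_mem {b b' : Fin n →₀ ℕ} (hb : IsTranslate ρ b b')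
    (hC : b ∈ multiples C) (hA : b ∉ multiples A) :
    shiftMap K A C ρ (monomial b 1) = monomial b' 1 := by
  rw [shiftMap, monomialMap_monomial, if_pos ⟨hC, hA⟩, hb.translate_eq]

theorem shiftMap_monomial_of_notMem {b : Fin n →₀ ℕ} (h : b ∈ multiples C → b ∈ multiples A) :
    shiftMap K A C ρ (monomial b 1) = monomial b 1 := by
  rw [shiftMap, monomialMap_monomial, if_neg fun hb ↦ hb.2 (h hb.1)]

namespace IsBinomialSystem

theorem mem_multiples_of_union (h : IsBinomialSystem n d A C ρ) {b : Fin n →₀ ℕ}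
    (hb : b ∈ multiples (A ∪ shiftSet C ρ)) (hC : b ∈ multiples C) : b ∈ multiples A := by
  rw [multiples_union] at hb
  exact hb.elim id fun hb ↦ h.multiples_inter hC hb

theorem shiftMap_mem (h : IsBinomialSystem n d A C ρ) {L : Fin n} (hL : 0 < ρ L)
    (hL' : ∀ j, L < j → ρ j = 0) {f : MvPolynomial (Fin n) K} (hf : f ∈ F K A C ρ) :
    shiftMap K A C ρ f ∈ Ideal.span (monomials K A) := by
  -- The map is only K-linear, so the induction over the ideal must carry arbitrary multipliers.
  suffices H : ∀ p, shiftMap K A C ρ (p * f) ∈ Ideal.span (monomials K A) by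
    simpa using H 1
  induction hf using Submodule.span_induction with
  | zero => simp
  | add x y _ _ hx hy =>
    intro p
    rw [mul_add, map_add]
    exact Ideal.add_mem _ (hx p) (hy p)
  | smul a x _ hx =>
    intro p
    rw [smul_eq_mul, ← mul_assoc]
    exact hx _
  | mem x hx =>
    refine map_mem_of_forall_monomial
      (shiftMap K A C ρ ∘ₗ LinearMap.mulRight K x) _ fun s ↦ ?_
    rw [LinearMap.comp_apply, LinearMap.mulRight_apply]
    rcases hx with ⟨a, ha, rfl⟩ | ⟨c, hc, c', hcc', rfl⟩
    · have hmem : s + a ∈ multiples A := ⟨a, ha, le_add_self⟩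
      rw [monomial_mul, one_mul, shiftMap_monomial_of_notMem fun _ ↦ hmem,
        monomial_mem_span_monomials]
      exact hmem
    · have hC : s + c ∈ multiples C := ⟨c, hc, le_add_self⟩
      have hC' : s + c' ∈ multiples (A ∪ shiftSet C ρ) :=
        ⟨c', Or.inr ⟨c, hc, hcc'⟩, le_add_self⟩
      rw [mul_sub, monomial_mul, monomial_mul, one_mul, map_sub,
        shiftMap_monomial_of_notMem (b := s + c') (h.mem_multiples_of_union hC')]
      -- Outside (X^A) the two terms of the binomial get the same image; inside, the second term
      -- also lies in (X^A), as ρ_L > 0.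
      by_cases hA : s + c ∈ multiples A
      · rw [shiftMap_monomial_of_notMem fun _ ↦ hA]
        exact Ideal.sub_mem _ (monomial_mem_span_monomials.mpr hA) (monomial_mem_span_monomials.mpr
          (h.translate_mem_multiples hL hL' (hcc'.add s) hC hA))
      · rw [shiftMap_monomial_of_mem (hcc'.add s) hC hA, sub_self]
        exact Ideal.zero_mem _

/-- `shiftMap` sends F into (X^A) and is the identity on (X^{A ∪ (C+ρ)}). -/
theorem mem_span_monomials_of_mem_F (h : IsBinomialSystem n d A C ρ) {L : Fin n} (hL : 0 < ρ L)
    (hL' : ∀ j, L < j → ρ j = 0) {f : MvPolynomial (Fin n) K} (hf : f ∈ F K A C ρ)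
    (hf' : f ∈ Ideal.span (monomials K (A ∪ shiftSet C ρ))) :
    f ∈ Ideal.span (monomials K A) := by
  have h1 := h.shiftMap_mem hL hL' hf
  rw [mem_span_monomials] at hf'
  rwa [shiftMap, monomialMap_congr (g' := fun s ↦ monomial s 1) fun s hs ↦
    if_neg fun hb ↦ hb.2 (h.mem_multiples_of_union (hf' s hs) hb.1), monomialMap_id] at h1

theorem span_monomials_le (h : IsBinomialSystem n d A C ρ) :
    Ideal.span (monomials K (A ∪ C ∪ (A ∪ shiftSet C ρ))) ≤
      F K A C ρ ⊔ Ideal.span (monomials K (A ∪ shiftSet C ρ)) := by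
  refine Ideal.span_le.mpr ?_
  rintro _ ⟨b, (hb | hb) | hb, rfl⟩
  · exact Ideal.mem_sup_left (span_monomials_le_F (Ideal.subset_span ⟨b, hb, rfl⟩))
  · obtain ⟨c, -, hc⟩ := h.shift_subset b hb
    rw [← sub_add_cancel (monomial b (1 : K)) (monomial c 1)]
    exact Submodule.add_mem_sup (Ideal.subset_span (Or.inr ⟨b, hb, c, hc, rfl⟩))
      (Ideal.subset_span ⟨c, Or.inr ⟨b, hb, hc⟩, rfl⟩)
  · exact Ideal.mem_sup_right (Ideal.subset_span ⟨b, hb, rfl⟩)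

theorem X_pow_mul_mem_F (h : IsBinomialSystem n d A C ρ) {L : Fin n} (hL : 0 < ρ L)
    (hL' : ∀ j, L < j → ρ j = 0) {m : ℕ} {f : MvPolynomial (Fin n) K}
    (hf : f ∈ tailSat m (F K A C ρ)) {j : Fin n} (hj : j.val ≤ m) :
    ∃ N : ℕ, X j ^ N * f ∈ F K A C ρ := by
  obtain ⟨N, hN⟩ := hf
  -- Write X_j^(N n) f = g + p with g ∈ F and p ∈ (X^{A ∪ (C+ρ)}). The tail power carries p into F,
  -- hence into (X^A), and a second factor X_j^(N n) carries p itself there.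
  obtain ⟨g, hg, p, hp, hgp⟩ := Submodule.mem_sup.mp
    (h.span_monomials_le (X_pow_mul_mem_of_tail_mul_mem h.borel_union hj (F_le hN)))
  have hpF : monomial (tailExp n m) 1 ^ N * p ∈ F K A C ρ := by
    rw [← eq_sub_iff_add_eq'] at hgp
    rw [hgp, mul_sub, mul_left_comm]
    exact Ideal.sub_mem _ (Ideal.mul_mem_left _ _ hN) (Ideal.mul_mem_left _ _ hg)
  have hpA := X_pow_mul_mem_of_tail_mul_mem h.borel_inter hj
    (h.mem_span_monomials_of_mem_F hL hL' hpF (Ideal.mul_mem_left _ _ hp))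
  refine ⟨N * n + N * n, ?_⟩
  rw [pow_add, mul_assoc, ← hgp, mul_add]
  exact Ideal.add_mem _ (Ideal.mul_mem_left _ _ hg) (span_monomials_le_F hpA)

theorem X_pow_mul_mem_F_of_lt (h : IsBinomialSystem n d A C ρ) {L : Fin n} (hL : 0 < ρ L)
    {m : ℕ} {f : MvPolynomial (Fin n) K}
    (hf : f ∈ tailSat m (Ideal.span (monomials K (A ∪ C ∪ (A ∪ shiftSet C ρ)))))
    {j : Fin n} (hj : j.val ≤ m) (hjL : j < L) : ∃ N : ℕ, X j ^ N * f ∈ F K A C ρ := by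
  obtain ⟨N, hN⟩ := hf
  obtain ⟨g, hg, p, hp, hgp⟩ := Submodule.mem_sup.mp
    (h.span_monomials_le (X_pow_mul_mem_of_tail_mul_mem h.borel_union hj hN))
  have hpA : X j ^ d * p ∈ Ideal.span (monomials K A) := by
    rw [X_pow_eq_monomial, monomial_mul_mem_span_monomials]
    intro s hs
    obtain ⟨v, hv, hvs⟩ := mem_span_monomials.mp hp s hs
    have hvL : v L ≤ d := by
      rw [← show ∑ i, v i = d from h.borel_right.1 hv]
      exact Finset.single_le_sum (fun i _ ↦ Nat.zero_le (v i)) (Finset.mem_univ L)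
    exact mem_multiples_of_le (h.single_add_mem_multiples hL hjL hv)
      (add_le_add (Finsupp.single_le_single.mpr hvL) hvs)
  refine ⟨d + N * n, ?_⟩
  rw [pow_add, mul_assoc, ← hgp, mul_add]
  exact Ideal.add_mem _ (Ideal.mul_mem_left _ _ hg) (span_monomials_le_F hpA)

theorem isWHomogeneous_F_one (h : IsBinomialSystem n d A C ρ) :
    IsWHomogeneous 1 (F K A C ρ) := by
  have hw (t : Fin n →₀ ℕ) (ht : t ∈ exponents n d) :
      Finsupp.weight (1 : Fin n → ℕ) t = d := by
    rw [← show ∑ i, t i = d from ht]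
    simp [Finsupp.weight_apply, Finsupp.sum_fintype]
  refine isWHomogeneous_F fun c hc b hb ↦ ?_
  rw [hw c (h.C_subset hc), hw b (h.shiftSet_subset ⟨c, hc, hb⟩)]

theorem isWHomogeneous_F_single {j : Fin n} (hj : ρ j = 0) :
    IsWHomogeneous (Pi.single j 1) (F K A C ρ) := by
  refine isWHomogeneous_F fun c _ b hb ↦ ?_
  have := hb j
  rw [weight_single_one, weight_single_one]
  omega

theorem isSeqCMFrom_tailSat (h : IsBinomialSystem n d A C ρ) {L : Fin n} (hL : 0 < ρ L)
    (hL' : ∀ j, L < j → ρ j = 0) (hL0 : 0 < L.val) {m : ℕ} (hLm : L.val ≤ m) (hm : m ≤ n) :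
    IsSeqCMFrom (n - m) (tailSat m (F K A C ρ)) := by
  induction m, hLm using Nat.le_induction with
  | base =>
    -- The passage to the monomial ideal: nilpotency is needed only for X_j with j ≤ l = L - 1,
    -- where j < L.
    obtain ⟨l, hl⟩ := Nat.exists_eq_succ_of_ne_zero hL0.ne'
    rw [hl]
    refine isSeqCMFrom_tailSat_step (by omega)
      (isSeqCMFrom_tailSat_monomials h.borel_union (by omega)) F_le h.isWHomogeneous_F_one
      (fun f hf j hj ↦ ?_)
      fun j hj ↦ ⟨isWHomogeneous_F_single (hL' j ?_), isWHomogeneous_span_monomials _ _⟩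
    · obtain ⟨N, hN⟩ := h.X_pow_mul_mem_F_of_lt hL hf hj (Fin.lt_def.mpr (by omega))
      exact ⟨N, le_satBy _ _ hN⟩
    · exact Fin.lt_def.mpr (by omega)
  | succ m hLm ih =>
    refine isSeqCMFrom_tailSat_step (by omega) (ih (by omega)) le_rfl h.isWHomogeneous_F_one
      (fun f hf j hj ↦ ?_) fun j hj ↦ ?_
    · obtain ⟨N, hN⟩ := h.X_pow_mul_mem_F hL hL' hf hj
      exact ⟨N, le_satBy _ _ hN⟩
    · have := isWHomogeneous_F_single (K := K) (A := A) (C := C)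
        (hL' j (Fin.lt_def.mpr (by omega)))
      exact ⟨this, this⟩

theorem exists_last_ne_zero (h : IsBinomialSystem n d A C ρ) (hC : C.Nonempty) :
    ∃ L : Fin n, ρ L ≠ 0 ∧ (∀ j, L < j → ρ j = 0) ∧ 0 < L.val := by
  obtain ⟨c, hc⟩ := hC
  obtain ⟨b, hb, hcb⟩ := h.shift_subset c hc
  have hne : (Finset.univ.filter fun i ↦ ρ i ≠ 0).Nonempty := by
    by_contra hcon
    have h0 (i : Fin n) : ρ i = 0 := by
      by_contra hi
      exact hcon ⟨i, by simpa using hi⟩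
    have : IsTranslate ρ c c := fun i ↦ by rw [h0 i, add_zero]
    exact Set.eq_empty_iff_forall_notMem.mp h.C_inter_shift c ⟨hc, c, hc, this⟩
  obtain ⟨L, hL, hmax⟩ := Finset.exists_max_image _ id hne
  have hLne : ρ L ≠ 0 := by simpa using hL
  have hlast (j : Fin n) (hj : L < j) : ρ j = 0 := by
    by_contra hj0
    exact (hmax j (by simpa using hj0)).not_gt hj
  -- The entries of ρ sum to zero, so ρ cannot be supported at the first index alone.
  refine ⟨L, hLne, hlast, Nat.pos_of_ne_zero fun hL0 ↦ hLne ?_⟩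
  have hsum : ∑ i, (b i : ℤ) = ∑ i, (c i : ℤ) := by
    have h1 : ∑ i, b i = d := hb
    have h2 : ∑ i, c i = d := h.C_subset hc
    exact_mod_cast h1.trans h2.symm
  rw [Finset.sum_congr rfl fun i _ ↦ hcb i, Finset.sum_add_distrib, add_eq_left] at hsum
  rwa [Finset.sum_eq_single L (fun j _ hj ↦ hlast j (Fin.lt_def.mpr
    (by have := Fin.val_ne_of_ne hj; omega))) (by simp)] at hsum

theorem isSequentiallyCM_of_last_pos (h : IsBinomialSystem n d A C ρ) {L : Fin n} (hL : 0 < ρ L)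
    (hL' : ∀ j, L < j → ρ j = 0) (hL0 : 0 < L.val) :
    IsSequentiallyCM (F K A C ρ) ∧ IsSequentiallyCM (saturation (F K A C ρ)) := by
  have hn : 0 < n := Fin.pos L
  rw [saturation_eq_tailSat hn fun f hf j ↦ h.X_pow_mul_mem_F hL hL' hf (by omega)]
  have h1 := h.isSeqCMFrom_tailSat (K := K) hL hL' hL0 L.2.le le_rfl
  rw [tailSat_self] at h1
  exact ⟨h1.isSequentiallyCM,
    (h.isSeqCMFrom_tailSat hL hL' hL0 (by omega) (Nat.sub_le n 1)).isSequentiallyCM⟩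

theorem isSequentiallyCM (h : IsBinomialSystem n d A C ρ) (hn : 0 < n) :
    IsSequentiallyCM (F K A C ρ) ∧ IsSequentiallyCM (saturation (F K A C ρ)) := by
  rcases C.eq_empty_or_nonempty with rfl | hC
  · have hA := h.borel_inter
    rw [F_empty]
    rw [saturation_eq_tailSat hn fun f ⟨N, hN⟩ j ↦
      ⟨N * n, X_pow_mul_mem_of_tail_mul_mem hA (by omega) hN⟩]
    have h1 := isSeqCMFrom_tailSat_monomials (K := K) hA le_rfl
    rw [tailSat_self] at h1
    exact ⟨h1.isSequentiallyCM,
      (isSeqCMFrom_tailSat_monomials hA (Nat.sub_le n 1)).isSequentiallyCM⟩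
  · obtain ⟨L, hL, hL', hL0⟩ := h.exists_last_ne_zero hC
    rcases hL.lt_or_gt with hneg | hpos
    · rw [← F_neg]
      exact h.neg.isSequentiallyCM_of_last_pos (by simpa using hneg)
        (fun j hj ↦ by simp [hL' j hj]) hL0
    · exact h.isSequentiallyCM_of_last_pos hpos hL' hL0

end IsBinomialSystem

end Binomial

end BinomialSystem

theorem mainTheorem5 {K : Type*} [Field K] [CharZero K] (n d : ℕ) (hn : 0 < n) (hd : 0 < d)
    (A C : Set (Fin n →₀ ℕ)) (ρ : Fin n → ℤ)
    (h : BinomialSystem.IsBinomialSystem n d A C ρ) :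
    BinomialSystem.IsSequentiallyCM (BinomialSystem.F K A C ρ) ∧
      BinomialSystem.IsSequentiallyCM (BinomialSystem.saturation (BinomialSystem.F K A C ρ)) :=
  h.isSequentiallyCM hn
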